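/- Let $\alpha$ be an ordinal, $\xi=\max\{\omega,\alpha\}$, and let $F$ be a field. Consider sequences $t=(t_\gamma)_{0<\gamma<\alpha}$ of ordinals $t_\gamma<\xi$; let $e_\beta$ be the sequence with entry $1$ at index $\beta$ and $0$ elsewhere, and let $\tau_\beta(t)$ be obtained from $t$ by replacing all entries with index $\le\beta$ by $0$. For $\beta<\alpha$ let $U_\beta$ be the set of all such $t$ with only finitely many nonzero entries, with $t_\gamma<\omega$ for every successor ordinal $\gamma$, with $t_\delta=0$ for all $\delta<\beta$ and, if $\beta$ is a (nonzero) limit ordinal, with $t_\beta<\beta$. Let $X_{0,r}$ ($r\in U_0$) be independent indeterminates over $F$, and define recursively, for $t\in U_\beta$, \[X_{\beta,t}=\prod_{k\ge 1}X_{\gamma,\,t+ke_\beta}^2\ \ (\beta=\gamma+1),\qquad X_{\beta,t}=\prod_{t_\beta<\gamma<\beta,\ \gamma\text{ a successor}}X_{\gamma,\,\tau_\beta(t)}^2\ \ (\beta\text{ a limit ordinal}),\] as (possibly infinite) formal products of powers of the $X_{0,r}$. A monomial is a finite product of elements $X_{\beta,t}$ with $\beta<\alpha$, $t\in U_\beta$;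 let $F[\mathbf X]$ be the monoid algebra over $F$ of the monoid of monomials, let $S$ be the set of all nonzero elements of $F[\mathbf X]$ that are not divisible by any monomial other than $1$, and put $D=S^{-1}F[\mathbf X]$. For $t\in U_0$ put $M_{0,t}=X_{0,t}D$ (if $\alpha>0$). If $0<\beta<\alpha$ and $t\in U_\beta$, let $M_{\beta,t}$ be the ideal of $D$ generated by the elements $X_{\beta,\,\tau_\beta(t)+\delta e_\beta}$, where $\delta$ ranges over the natural numbers if $\beta$ is a successor ordinal, and over all ordinals $\delta<\beta$ if $\beta$ is a limit ordinal. Let $\mathcal M=\{M_{\beta,t}\mid \beta<\alpha,\ t\in U_\beta\}$. Then $\mathrm{Spec}(D)=\mathcal M\cup\{0\}$, and every ideal in $\mathcal M$ is nonzero and maximal. -/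

import Mathlib

universe u v

noncomputable section

open scoped Classical in
/-- `τ_β(t)`: keep the components of `t` with index `> β`, replace all others by `0`. -/
def tau (β : Ordinal.{u}) (t : Ordinal.{u} →₀ Ordinal.{u}) : Ordinal.{u} →₀ Ordinal.{u} :=
  t.filter (fun γ => β < γ)

/-- Successor ordinals. (Limit ordinals, in the sense "neither zero nor a successor", are
`Order.IsSuccLimit`.) -/
def IsSuc (β : Ordinal.{u}) : Prop := ∃ γ, β = γ + 1

/-- The set `U_β`. An element of `ξ^{α ∖ {0}}`, `ξ = max {ω, α}`, with finitely many nonzero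
components is written as a finitely supported function on all ordinals that vanishes at every
index outside `α ∖ {0}`. -/
def U (α β : Ordinal.{u}) : Set (Ordinal.{u} →₀ Ordinal.{u}) :=
  {t | (∀ γ, ¬ (0 < γ ∧ γ < α) → t γ = 0) ∧
    (∀ γ, t γ < max Ordinal.omega0 α) ∧
    (∀ γ, IsSuc γ → t γ < Ordinal.omega0) ∧
    (∀ δ, δ < β → t δ = 0) ∧
    (Order.IsSuccLimit β → t β < β)}

/-- The vertices `X_{β,t}` (`β < α`, `t ∈ U_β`) of the graph `𝒯`; `β` is the height. -/
@[ext]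
structure Vertex (α : Ordinal.{u}) where
  height : Ordinal.{u}
  seq : Ordinal.{u} →₀ Ordinal.{u}
  height_lt : height < α
  seq_mem : seq ∈ U α height

variable {α : Ordinal.{u}}

/-- The edges of `𝒯`: `(X_{γ+1,t}, X_{γ,t + k e_{γ+1}})` for positive integers `k`, and, for a
limit ordinal `β`, `(X_{β,t}, X_{γ,τ_β(t)})` for the successor ordinals `γ` with
`t_β < γ < β`. -/
def Edge (x y : Vertex α) : Prop :=
  (x.height = y.height + 1 ∧
    ∃ k : ℕ, 0 < k ∧ y.seq = x.seq + Finsupp.single x.height (k : Ordinal.{u})) ∨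
  (Order.IsSuccLimit x.height ∧ IsSuc y.height ∧ y.height < x.height ∧
    x.seq x.height < y.height ∧ y.seq = tau x.height x.seq)

theorem Edge.height_lt {x y : Vertex α} (h : Edge x y) : y.height < x.height := by
  rcases h with ⟨h, -⟩ | ⟨-, -, h, -⟩
  · rw [h]; exact Order.lt_add_one_iff.2 le_rfl
  · exact h

open scoped Classical in
/-- The multiplicity of the indeterminate `X_{0,r}` in `X_{β,t}`, where the `X_{0,r}` are
independent indeterminates and `X = ∏_{(X,Y) ∈ 𝒯} Y²` for every vertex `X` of positive height.
By `exponent_support_subsingleton` at most one term of the sum is nonzero. -/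
def exponent (x : Vertex α) (r : U α 0) : ℕ :=
  if x.height = 0 then (if x.seq = r.1 then 1 else 0)
  else ∑ᶠ y : {y : Vertex α // Edge x y}, 2 * exponent y.1 r
termination_by x.height
decreasing_by exact y.2.height_lt

variable (α) in
/-- The monoid of all monomials, i.e. of all finite products of vertices; a (possibly infinite)
product of powers of the `X_{0,r}` is written additively as its family of exponents. -/
def monomials : AddSubmonoid (U α 0 → ℕ) :=
  AddSubmonoid.closure (Set.range (exponent (α := α)))

variable (α) in
/-- The domain `F[𝐗]`: the monoid algebra over `F` of the monoid of all monomials. -/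
abbrev PolyX (F : Type v) [Field F] : Type _ := AddMonoidAlgebra F (monomials α)

/-- The vertex `X_{β,t}` as an element of `F[𝐗]`. -/
def varX (F : Type v) [Field F] (x : Vertex α) : PolyX α F :=
  AddMonoidAlgebra.single
    (⟨exponent x, AddSubmonoid.subset_closure ⟨x, rfl⟩⟩ : monomials α) (1 : F)

variable (α) in
/-- The set `S` of all elements of `F[𝐗]` that are not divisible by a proper monomial, i.e. by a
monomial other than `1`. For `α > 0` the clause `f ≠ 0` is implied by the second one. -/
def setS (F : Type v) [Field F] : Set (PolyX α F) :=
  {f | f ≠ 0 ∧ ∀ m : monomials α, m ≠ 0 → ¬ (AddMonoidAlgebra.single m (1 : F) ∣ f)}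

variable (α) in
/-- The domain `D = S⁻¹ F[𝐗]`. -/
abbrev DomainD (F : Type v) [Field F] : Type _ := Localization (Submonoid.closure (setS α F))

/-- The vertices that generate `M_{β,t}`: `X_{0,t}` if `β = 0`, the `X_{β,τ_β(t) + i e_β}` with
`i` a natural number if `β` is a successor, the `X_{β,τ_β(t) + δ e_β}` with `δ < β` if `β` is a
limit ordinal. (These sequences all lie in `U_β`: see `tau_add_single_mem`.) -/
def genM (x : Vertex α) : Set (Vertex α) :=
  {y | y.height = x.height ∧
    ((x.height = 0 ∧ y.seq = x.seq) ∨
     (IsSuc x.height ∧ ∃ i : ℕ,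
        y.seq = tau x.height x.seq + Finsupp.single x.height (i : Ordinal.{u})) ∨
     (Order.IsSuccLimit x.height ∧ ∃ δ < x.height,
        y.seq = tau x.height x.seq + Finsupp.single x.height δ))}

/-- The ideal `M_{β,t}` of `D`. -/
def idealM (F : Type v) [Field F] (x : Vertex α) : Ideal (DomainD α F) :=
  Ideal.span ((fun y => algebraMap (PolyX α F) (DomainD α F) (varX F y)) '' genM x)

variable (α) in
/-- The collection `𝓜` of all ideals `M_{β,t}`, `β < α`, `t ∈ U_β`. -/
def collM (F : Type v) [Field F] : Set (Ideal (DomainD α F)) := Set.range (idealM (α := α) F)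

/-! Well-definedness of the above. -/

theorem tau_apply (β γ : Ordinal.{u}) (t : Ordinal.{u} →₀ Ordinal.{u}) [Decidable (β < γ)] :
    tau β t γ = if β < γ then t γ else 0 := by
  simp [tau, Finsupp.filter_apply]

theorem not_isSuc_of_isSuccLimit {β : Ordinal.{u}} (h : Order.IsSuccLimit β) : ¬ IsSuc β := by
  rintro ⟨γ, rfl⟩
  exact Order.not_isSuccLimit_add_one γ h

/-- The sequences in the definition of `genM` lie in `U_β`. -/
theorem tau_add_single_mem (x : Vertex α) (δ : Ordinal.{u})
    (h : (IsSuc x.height ∧ δ < Ordinal.omega0) ∨ (Order.IsSuccLimit x.height ∧ δ < x.height)) :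
    tau x.height x.seq + Finsupp.single x.height δ ∈ U α x.height := by
  classical
  obtain ⟨h1, h2, h3, h4, h5⟩ := x.seq_mem
  have hpos : 0 < x.height := by
    rcases h with ⟨⟨γ, h⟩, -⟩ | ⟨h, -⟩
    · rw [h]; exact lt_of_le_of_lt (zero_le (a := γ)) (Order.lt_add_one_iff.2 le_rfl)
    · exact h.bot_lt
  have key : ∀ γ, (tau x.height x.seq + Finsupp.single x.height δ) γ =
      if x.height < γ then x.seq γ else if x.height = γ then δ else 0 := by
    intro γ
    rw [Finsupp.add_apply, tau_apply, Finsupp.single_apply]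
    split_ifs with a b
    · exact absurd b a.ne
    all_goals simp
  refine ⟨?_, ?_, ?_, ?_, ?_⟩
  · intro γ hγ
    rw [key]
    split_ifs with a b
    · exact h1 γ hγ
    · exact absurd ⟨b ▸ hpos, b ▸ x.height_lt⟩ hγ
    · rfl
  · intro γ
    rw [key]
    split_ifs with a b
    · exact h2 γ
    · rcases h with ⟨-, h⟩ | ⟨-, h⟩
      · exact lt_max_of_lt_left h
      · exact lt_max_of_lt_right (h.trans x.height_lt)
    · exact lt_max_of_lt_left Ordinal.omega0_pos
  · intro γ hγ
    rw [key]
    split_ifs with a b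
    · exact h3 γ hγ
    · rcases h with ⟨-, h⟩ | ⟨h, -⟩
      · exact h
      · exact absurd (b ▸ hγ) (not_isSuc_of_isSuccLimit h)
    · exact Ordinal.omega0_pos
  · intro γ hγ
    rw [key, if_neg hγ.not_gt, if_neg hγ.ne']
  · intro hl
    rw [key, if_neg (lt_irrefl _), if_pos rfl]
    rcases h with ⟨h, -⟩ | ⟨-, h⟩
    · exact absurd h (not_isSuc_of_isSuccLimit hl)
    · exact h

/-- The endpoints in the definition of the edges below a successor height are vertices. -/
theorem add_single_mem {γ : Ordinal.{u}} (x : Vertex α) (h : x.height = γ + 1) (k : ℕ) :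
    x.seq + Finsupp.single x.height (k : Ordinal.{u}) ∈ U α γ := by
  classical
  obtain ⟨h1, h2, h3, h4, h5⟩ := x.seq_mem
  have hlt : γ < x.height := by rw [h]; exact Order.lt_add_one_iff.2 le_rfl
  have hpos : 0 < x.height := lt_of_le_of_lt (zero_le (a := γ)) hlt
  have key : ∀ ε, ε ≠ x.height →
      (x.seq + Finsupp.single x.height (k : Ordinal.{u})) ε = x.seq ε := by
    intro ε hε
    simp [hε.symm]
  have key' : (x.seq + Finsupp.single x.height (k : Ordinal.{u})) x.height < Ordinal.omega0 := by
    rw [Finsupp.add_apply, Finsupp.single_eq_same]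
    exact Ordinal.isPrincipal_add_omega0 (h3 _ ⟨γ, h⟩) (Ordinal.natCast_lt_omega0 k)
  refine ⟨?_, ?_, ?_, ?_, ?_⟩
  · intro ε hε
    by_cases e : ε = x.height
    · exact absurd ⟨e ▸ hpos, e ▸ x.height_lt⟩ hε
    · rw [key ε e]; exact h1 ε hε
  · intro ε
    by_cases e : ε = x.height
    · rw [e]; exact lt_max_of_lt_left key'
    · rw [key ε e]; exact h2 ε
  · intro ε hε
    by_cases e : ε = x.height
    · rw [e]; exact key'
    · rw [key ε e]; exact h3 ε hε
  · intro ε hε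
    rw [key ε (hε.trans hlt).ne]; exact h4 ε (hε.trans hlt)
  · intro hl
    rw [key γ hlt.ne, h4 γ hlt]; exact hl.bot_lt

/-- The endpoints in the definition of the edges below a limit height are vertices. -/
theorem tau_mem {γ : Ordinal.{u}} (x : Vertex α) (hγ : γ < x.height) (hs : IsSuc γ) :
    tau x.height x.seq ∈ U α γ := by
  classical
  obtain ⟨h1, h2, h3, h4, h5⟩ := x.seq_mem
  refine ⟨?_, ?_, ?_, ?_, ?_⟩
  · intro ε hε
    rw [tau_apply, h1 ε hε, ite_self]
  · intro ε
    rw [tau_apply]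
    split_ifs
    · exact h2 ε
    · exact lt_max_of_lt_left Ordinal.omega0_pos
  · intro ε hε
    rw [tau_apply]
    split_ifs
    · exact h3 ε hε
    · exact Ordinal.omega0_pos
  · intro ε hε
    rw [tau_apply, if_neg (hε.trans hγ).not_gt]
  · intro hl
    exact absurd hs (not_isSuc_of_isSuccLimit hl)

/-- If `X_{0,r}` occurs in `X_{β,t}`, then `r` and `t` agree above `β`, and `r_β > t_β` if `β` is
a successor. -/
theorem exponent_ne_zero (r : U α 0) (β : Ordinal.{u}) :
    ∀ x : Vertex α, x.height = β → exponent x r ≠ 0 →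
      (∀ γ, β < γ → x.seq γ = r.1 γ) ∧ (IsSuc β → x.seq β < r.1 β) := by
  classical
  induction β using WellFoundedLT.induction with
  | ind β ih =>
    intro x hx hne
    rw [exponent] at hne
    split_ifs at hne with h0 h1
    · refine ⟨fun γ _ => by rw [h1], ?_⟩
      rintro ⟨γ, hγ⟩
      rw [← hx, h0] at hγ
      exact absurd hγ.symm (Order.lt_add_one_iff.2 (zero_le (a := γ))).ne'
    · exact absurd rfl hne
    · obtain ⟨⟨y, hy⟩, hne'⟩ : ∃ y : {y : Vertex α // Edge x y}, 2 * exponent y.1 r ≠ 0 := by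
        by_contra hcon
        push Not at hcon
        exact hne (by rw [finsum_congr hcon, finsum_zero])
      have hyr : exponent y r ≠ 0 := fun h => hne' (by simp [h])
      obtain ⟨i1, i2⟩ := ih y.height (hx ▸ hy.height_lt) y rfl hyr
      have hlt := hy.height_lt
      rcases hy with ⟨e, k, hk, hs⟩ | ⟨hl, hs, hl2, ht, hs2⟩
      · constructor
        · intro γ hγ
          rw [← i1 γ (hlt.trans (hx ▸ hγ)), hs]
          simp [hx, hγ.ne]
        · intro _
          rw [← i1 β (hx ▸ hlt), hs, hx, Finsupp.add_apply, Finsupp.single_eq_same]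
          exact lt_add_of_pos_right _ (by exact_mod_cast hk)
      · constructor
        · intro γ hγ
          rw [← i1 γ (hlt.trans (hx ▸ hγ)), hs2, tau_apply, if_pos (hx ▸ hγ)]
        · intro h
          exact absurd h (not_isSuc_of_isSuccLimit (hx ▸ hl))

/-- At most one factor of the product `X = ∏_{(X,Y) ∈ 𝒯} Y²` involves a given `X_{0,r}`. -/
theorem exponent_support_subsingleton (x : Vertex α) (r : U α 0) :
    {y : Vertex α | Edge x y ∧ exponent y r ≠ 0}.Subsingleton := by
  classical
  rintro y ⟨hy, hyr⟩ z ⟨hz, hzr⟩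
  obtain ⟨y1, y2⟩ := exponent_ne_zero r _ y rfl hyr
  obtain ⟨z1, z2⟩ := exponent_ne_zero r _ z rfl hzr
  have hylt := hy.height_lt
  have hzlt := hz.height_lt
  rcases hy with ⟨e, k, hk, hs⟩ | ⟨hl, hs, hl2, ht, hs2⟩ <;>
    rcases hz with ⟨e', k', hk', hs'⟩ | ⟨hl', hs', hl2', ht', hs2'⟩
  · have hh : y.height = z.height := Order.add_one_inj.1 (e.symm.trans e')
    have a := y1 _ hylt
    have b := z1 _ hzlt
    rw [hs, Finsupp.add_apply, Finsupp.single_eq_same] at a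
    rw [hs', Finsupp.add_apply, Finsupp.single_eq_same, ← a] at b
    have hkk : (k' : Ordinal.{u}) = k := add_left_cancel b
    exact Vertex.ext hh (by rw [hs, hs', hkk])
  · exact absurd ⟨_, e⟩ (not_isSuc_of_isSuccLimit hl')
  · exact absurd ⟨_, e'⟩ (not_isSuc_of_isSuccLimit hl)
  · have hyz : y.seq = z.seq := hs2.trans hs2'.symm
    rcases lt_trichotomy y.height z.height with h | h | h
    · have := z2 hs'
      rw [← y1 _ h, hyz] at this
      exact absurd this (lt_irrefl _)
    · exact Vertex.ext h hyz
    · have := y2 hs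
      rw [← z1 _ h, hyz] at this
      exact absurd this (lt_irrefl _)

end

/-! ### Vertices obtained by changing the entry `t_β`. -/

section Combinatorics

variable {α : Ordinal.{u}}

/-! The engine is a divisibility chain. Raising the entry `t_β` of `X_{β,t}` from `δ` to `δ'` only
discards factors of the defining product, and what is discarded is a finite product of vertices of
height less than `β` (`exponent_shift_of_le`). So the generators of `M_{β,t}` form a chain under
divisibility, and every element of `M_{β,t}` is a multiple of a single generator.

The chain also yields greatest common divisors of monomials, equal to pointwise minima of exponents
(`hasGcd_monomials`). Given two products of vertices of height at most `β`, raise all entries at `β`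
to one large `δ`. The resulting vertices of height `β` are pairwise equal or disjoint, and disjoint
from all remaining factors, which have smaller height and are covered by induction.

Hence a nonzero polynomial is a monomial times an element of `S`, and `S` is multiplicatively closed
by a Gauss-type argument with the specializations `X_{0,r} ↦ 0`. Every nonzero element of `D` is
therefore associated to a monomial, and the sum of two distinct disjoint monomials is a unit.

Maximality of `M_{β,t}`: a monomial is a multiple of some generator or disjoint from some generator
(`exists_shift_dvd_or_expDisjoint`); in the second case the two add up to a unit. Conversely, a
nonzero prime `P` contains a vertex; take one of least height. Going up its chain splits off only
vertices of smaller height, none of which lie in `P`, so `P` contains the whole chain, and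
maximality gives equality. -/

/-- The ordinals `δ` for which `X_{β, τ_β(t) + δ e_β}` is a vertex. -/
def Valid (β δ : Ordinal.{u}) : Prop :=
  (β = 0 ∧ δ = 0) ∨ (IsSuc β ∧ δ < Ordinal.omega0) ∨ (Order.IsSuccLimit β ∧ δ < β)

theorem not_isSuc_zero : ¬ IsSuc (0 : Ordinal.{u}) := by
  rintro ⟨γ, hγ⟩
  exact absurd hγ.symm (Order.lt_add_one_iff.2 (zero_le (a := γ))).ne'

theorem IsSuc.ne_zero {β : Ordinal.{u}} (h : IsSuc β) : β ≠ 0 := by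
  rintro rfl; exact not_isSuc_zero h

theorem isSuc_add_one (γ : Ordinal.{u}) : IsSuc (γ + 1) := ⟨γ, rfl⟩

theorem zero_or_isSuc_or_isSuccLimit (β : Ordinal.{u}) :
    β = 0 ∨ IsSuc β ∨ Order.IsSuccLimit β := by
  rcases Ordinal.zero_or_succ_or_isSuccLimit β with h | ⟨γ, h⟩ | h
  · exact Or.inl h
  · exact Or.inr (Or.inl ⟨γ, by rw [← h, Order.succ_eq_add_one]⟩)
  · exact Or.inr (Or.inr h)

theorem Valid.max {β δ ε : Ordinal.{u}} (h : Valid β δ) (h' : Valid β ε) :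
    Valid β (max δ ε) := by
  rcases le_total δ ε with e | e
  · rwa [max_eq_right e]
  · rwa [max_eq_left e]

theorem Vertex.seq_zero (x : Vertex α) : x.seq 0 = 0 :=
  x.seq_mem.1 0 fun h => lt_irrefl _ h.1

theorem Vertex.seq_of_lt (x : Vertex α) {γ : Ordinal.{u}} (h : γ < x.height) : x.seq γ = 0 :=
  x.seq_mem.2.2.2.1 γ h

theorem valid_seq (x : Vertex α) : Valid x.height (x.seq x.height) := by
  rcases zero_or_isSuc_or_isSuccLimit x.height with h | h | h
  · exact Or.inl ⟨h, by rw [h, x.seq_zero]⟩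
  · exact Or.inr (Or.inl ⟨h, x.seq_mem.2.2.1 _ h⟩)
  · exact Or.inr (Or.inr ⟨h, x.seq_mem.2.2.2.2 h⟩)

/-- Unlike in `tau_mem`, limit `γ` are allowed: cutting a limit product at a limit ordinal produces
a vertex of that height. -/
theorem tau_mem_of_le (x : Vertex α) {γ : Ordinal.{u}} (hγ : γ ≤ x.height) :
    tau x.height x.seq ∈ U α γ := by
  classical
  obtain ⟨h1, h2, h3, h4, h5⟩ := x.seq_mem
  refine ⟨?_, ?_, ?_, ?_, ?_⟩
  · intro ε hε
    rw [tau_apply, h1 ε hε, ite_self]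
  · intro ε
    rw [tau_apply]
    split_ifs
    · exact h2 ε
    · exact lt_max_of_lt_left Ordinal.omega0_pos
  · intro ε hε
    rw [tau_apply]
    split_ifs
    · exact h3 ε hε
    · exact Ordinal.omega0_pos
  · intro ε hε
    rw [tau_apply, if_neg (hε.trans_le hγ).not_gt]
  · intro hl
    rw [tau_apply, if_neg hγ.not_gt]
    exact hl.bot_lt

theorem shift_mem (x : Vertex α) {δ : Ordinal.{u}} (h : Valid x.height δ) :
    tau x.height x.seq + Finsupp.single x.height δ ∈ U α x.height := by
  rcases h with ⟨-, rfl⟩ | h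
  · simpa using tau_mem_of_le x le_rfl
  · exact tau_add_single_mem x δ h

/-- The vertex `X_{β, τ_β(t) + δ e_β}`, where `x = X_{β,t}`. -/
@[simps] noncomputable def shift (x : Vertex α) (δ : Ordinal.{u}) (h : Valid x.height δ) :
    Vertex α :=
  ⟨x.height, tau x.height x.seq + Finsupp.single x.height δ, x.height_lt, shift_mem x h⟩

open scoped Classical in
theorem shift_seq_apply (x : Vertex α) {δ : Ordinal.{u}} (h : Valid x.height δ)
    (γ : Ordinal.{u}) : (shift x δ h).seq γ =
      if x.height < γ then x.seq γ else if x.height = γ then δ else 0 := by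
  rw [shift_seq, Finsupp.add_apply, tau_apply, Finsupp.single_apply]
  split_ifs with a b
  · exact absurd b a.ne
  all_goals simp

theorem shift_seq_height (x : Vertex α) {δ : Ordinal.{u}} (h : Valid x.height δ) :
    (shift x δ h).seq x.height = δ := by
  classical
  rw [shift_seq_apply, if_neg (lt_irrefl _), if_pos rfl]

theorem tau_shift (x : Vertex α) {δ : Ordinal.{u}} (h : Valid x.height δ) :
    tau x.height (shift x δ h).seq = tau x.height x.seq := by
  classical
  ext γ
  rw [tau_apply, tau_apply, shift_seq_apply]
  split_ifs <;> rfl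

theorem shift_self (x : Vertex α) : shift x (x.seq x.height) (valid_seq x) = x := by
  classical
  refine Vertex.ext rfl (Finsupp.ext fun γ => ?_)
  rw [shift_seq_apply]
  split_ifs with a b
  · rfl
  · rw [b]
  · exact (x.seq_of_lt (lt_of_le_of_ne (not_lt.1 a) (Ne.symm b))).symm

/-- Makes the three kinds of height uniform; at height `0` only `δ = 0` is valid, and the shift is
`x` itself. -/
theorem mem_genM_iff {x y : Vertex α} : y ∈ genM x ↔ ∃ δ h, y = shift x δ h := by
  constructor
  · rintro ⟨h, ⟨h0, hs⟩ | ⟨hs, i, hi⟩ | ⟨hl, δ, hδ, hs⟩⟩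
    · refine ⟨_, valid_seq x, ?_⟩
      rw [shift_self]
      exact Vertex.ext h hs
    · exact ⟨i, Or.inr (Or.inl ⟨hs, Ordinal.natCast_lt_omega0 i⟩), Vertex.ext h hi⟩
    · exact ⟨δ, Or.inr (Or.inr ⟨hl, hδ⟩), Vertex.ext h hs⟩
  · rintro ⟨δ, h, rfl⟩
    refine ⟨rfl, ?_⟩
    rcases id h with ⟨h0, hδ⟩ | ⟨hs, hδ⟩ | ⟨hl, hδ⟩
    · refine Or.inl ⟨h0, ?_⟩
      have : δ = x.seq x.height := by rw [hδ, h0, x.seq_zero]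
      subst this
      rw [shift_self]
    · obtain ⟨n, rfl⟩ := Ordinal.lt_omega0.1 hδ
      exact Or.inr (Or.inl ⟨hs, n, rfl⟩)
    · exact Or.inr (Or.inr ⟨hl, δ, hδ, rfl⟩)

theorem exponent_of_height_ne_zero {x : Vertex α} (hx : x.height ≠ 0) (r : U α 0) :
    exponent x r = ∑ᶠ y ∈ {y | Edge x y}, 2 * exponent y r := by
  rw [exponent, if_neg hx]
  exact finsum_set_coe_eq_finsum_mem (f := fun y => 2 * exponent y r) {y | Edge x y}

theorem finite_edge_inter_support (x : Vertex α) (r : U α 0) :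
    ({y | Edge x y} ∩ Function.support fun y => 2 * exponent y r).Finite := by
  refine Set.Subsingleton.finite ?_
  refine (exponent_support_subsingleton x r).anti ?_
  rintro y ⟨hy, hyr⟩
  exact ⟨hy, fun h => hyr (by simp [h])⟩

theorem exists_edge_of_exponent_ne_zero {x : Vertex α} (hx : x.height ≠ 0) {r : U α 0}
    (h : exponent x r ≠ 0) : ∃ y, Edge x y ∧ exponent y r ≠ 0 := by
  by_contra! hcon
  refine h ?_
  rw [exponent_of_height_ne_zero hx]
  exact finsum_mem_eq_zero_of_forall_eq_zero fun y hy => by simp [hcon y hy]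

/-- Separating one factor from the product that defines a vertex. -/
theorem exponent_eq_add_of_edge_iff {x x' c : Vertex α} (hx : x.height ≠ 0)
    (hx' : x'.height ≠ 0) (hc : ¬ Edge x' c) (h : ∀ y, Edge x y ↔ y = c ∨ Edge x' y) :
    exponent x = exponent c + exponent c + exponent x' := by
  ext r
  have : {y | Edge x y} = insert c {y | Edge x' y} := Set.ext h
  rw [exponent_of_height_ne_zero hx, this,
    finsum_mem_insert' (s := {y | Edge x' y}) _ hc (finite_edge_inter_support x' r),
    Pi.add_apply, Pi.add_apply, exponent_of_height_ne_zero hx', two_mul]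

theorem exponent_eq_add_of_edge_iff_or {x x' c : Vertex α} (hx : x.height ≠ 0)
    (hx' : x'.height ≠ 0) (hc0 : c.height ≠ 0) (hc : ∀ y, Edge c y → ¬ Edge x' y)
    (h : ∀ y, Edge x y ↔ Edge c y ∨ Edge x' y) :
    exponent x = exponent c + exponent x' := by
  ext r
  have : {y | Edge x y} = {y | Edge c y} ∪ {y | Edge x' y} := Set.ext h
  rw [exponent_of_height_ne_zero hx, this,
    finsum_mem_union' (s := {y | Edge c y}) (t := {y | Edge x' y}) (Set.disjoint_left.2 hc)
      (finite_edge_inter_support c r)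
      (finite_edge_inter_support x' r), Pi.add_apply,
    exponent_of_height_ne_zero hx', exponent_of_height_ne_zero hc0]

theorem edge_iff_of_succ {x y : Vertex α} (hx : IsSuc x.height) : Edge x y ↔
    x.height = y.height + 1 ∧
      ∃ k : ℕ, 0 < k ∧ y.seq = x.seq + Finsupp.single x.height (k : Ordinal.{u}) :=
  or_iff_left fun h => not_isSuc_of_isSuccLimit h.1 hx

theorem edge_iff_of_isSuccLimit {x y : Vertex α} (hx : Order.IsSuccLimit x.height) :
    Edge x y ↔ IsSuc y.height ∧ y.height < x.height ∧ x.seq x.height < y.height ∧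
      y.seq = tau x.height x.seq := by
  unfold Edge
  rw [or_iff_right fun h => not_isSuc_of_isSuccLimit hx ⟨_, h.1⟩]
  exact and_iff_right hx

/-! ### Disjointness of vertices. -/

/-- A sufficient condition for a vertex `y` of height less than `β` to have no indeterminate in
common with the vertices `X_{β,t}` with `t_β = δ`. -/
def Below (β δ : Ordinal.{u}) (y : Vertex α) : Prop :=
  y.height < β ∧ (IsSuc β → y.seq β ≤ δ) ∧
    (Order.IsSuccLimit β → y.height ≤ δ ∧ ∀ ε, δ < ε → ε < β → y.seq ε = 0)

theorem Below.mono {β : Ordinal.{u}} {y : Vertex α} {δ δ' : Ordinal.{u}} (h : Below β δ y)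
    (hle : δ ≤ δ') : Below β δ' y :=
  ⟨h.1, fun hs => (h.2.1 hs).trans hle, fun hl => ⟨(h.2.2 hl).1.trans hle,
    fun ε h1 h2 => (h.2.2 hl).2 ε (hle.trans_lt h1) h2⟩⟩

/-- The limit case rests on finite support: `δ` is the maximum of the height of `y` and the largest
index below `β` with a nonzero entry. -/
theorem exists_below {β : Ordinal.{u}} {y : Vertex α} (h : y.height < β) :
    ∃ δ, Valid β δ ∧ Below β δ y := by
  classical
  rcases zero_or_isSuc_or_isSuccLimit β with h0 | hs | hl
  · exact absurd h (by simp [h0])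
  · exact ⟨y.seq β, Or.inr (Or.inl ⟨hs, y.seq_mem.2.2.1 _ hs⟩), h, fun _ => le_rfl,
      fun hl => absurd hs (not_isSuc_of_isSuccLimit hl)⟩
  · refine ⟨max y.height ((y.seq.support.filter (· < β)).sup id),
      Or.inr (Or.inr ⟨hl, max_lt h ?_⟩), h, fun hs => absurd hs (not_isSuc_of_isSuccLimit hl),
      fun _ => ⟨le_max_left _ _, fun ε h1 h2 => ?_⟩⟩
    · rw [Finset.sup_lt_iff hl.bot_lt]
      intro ε hε
      exact (Finset.mem_filter.1 hε).2
    · by_contra hne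
      refine absurd h1 (not_lt.2 (le_max_of_le_right ?_))
      exact Finset.le_sup (f := id) (Finset.mem_filter.2 ⟨Finsupp.mem_support_iff.2 hne, h2⟩)

/-- Two families of exponents without a common indeterminate. -/
def ExpDisjoint (m n : U α 0 → ℕ) : Prop := ∀ r, m r = 0 ∨ n r = 0

/-- A common `X_{0,r}` forces `r` to agree with `y` above the height of `y`. For successor `β` this
gives `r_β ≤ δ`, against `r_β > δ`. For limit `β`, `r` occurs in a factor of successor height `ε`
with `δ < ε < β`, so `r_ε > 0`, against `y_ε = 0`. -/
theorem Below.expDisjoint {x y : Vertex α} {δ : Ordinal.{u}} (hδ : Valid x.height δ)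
    (h : Below x.height δ y) : ExpDisjoint (exponent y) (exponent (shift x δ hδ)) := by
  intro r
  by_contra! hcon
  obtain ⟨hy, hx⟩ := hcon
  obtain ⟨y1, -⟩ := exponent_ne_zero r _ y rfl hy
  obtain ⟨x1, x2⟩ := exponent_ne_zero r _ (shift x δ hδ) rfl hx
  rcases zero_or_isSuc_or_isSuccLimit x.height with h0 | hs | hl
  · exact absurd h.1 (by simp [h0])
  · have := x2 hs
    rw [shift_height, shift_seq_height, ← y1 _ h.1] at this
    exact absurd this (not_lt.2 (h.2.1 hs))
  · obtain ⟨z, hz, hzr⟩ := exists_edge_of_exponent_ne_zero (x := shift x δ hδ)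
      hl.bot_lt.ne' hx
    rw [edge_iff_of_isSuccLimit (show Order.IsSuccLimit (shift x δ hδ).height from hl),
      shift_height, shift_seq_height] at hz
    obtain ⟨hzs, hzx, hδz, -⟩ := hz
    obtain ⟨hyδ, hy0⟩ := h.2.2 hl
    have := (exponent_ne_zero r _ z rfl hzr).2 hzs
    rw [← y1 _ (hyδ.trans_lt hδz), hy0 _ hδz hzx] at this
    exact not_lt_zero this

theorem expDisjoint_of_tau_ne {x y : Vertex α} (h : x.height = y.height)
    (ht : tau x.height x.seq ≠ tau y.height y.seq) : ExpDisjoint (exponent x) (exponent y) := by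
  classical
  intro r
  by_contra! hcon
  obtain ⟨x1, -⟩ := exponent_ne_zero r _ x rfl hcon.1
  obtain ⟨y1, -⟩ := exponent_ne_zero r _ y rfl hcon.2
  refine ht (Finsupp.ext fun γ => ?_)
  rw [tau_apply, tau_apply, h]
  split_ifs with hγ
  · rw [x1 γ (h ▸ hγ), y1 γ hγ]
  · rfl

/-! ### The divisibility chain. -/

/-- The monoid generated by the vertices that satisfy `Below β δ`. -/
noncomputable def belowMonoid (α β δ : Ordinal.{u}) : AddSubmonoid (U α 0 → ℕ) :=
  AddSubmonoid.closure (exponent '' {y | Below β δ y})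

theorem belowMonoid_mono (β : Ordinal.{u}) {δ δ' : Ordinal.{u}} (h : δ ≤ δ') :
    belowMonoid α β δ ≤ belowMonoid α β δ' :=
  AddSubmonoid.closure_mono (Set.image_mono fun _ hy => Below.mono hy h)

theorem exponent_mem_belowMonoid {y : Vertex α} {β δ : Ordinal.{u}} (h : Below β δ y) :
    exponent y ∈ belowMonoid α β δ :=
  AddSubmonoid.subset_closure ⟨y, h, rfl⟩

/-- The `k`-th factor for entry `n + 1` is the `(k+1)`-st factor for entry `n`, so only the square
of the first factor `c` is lost. -/
theorem exponent_shift_natCast (x : Vertex α) (hs : IsSuc x.height) (n : ℕ)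
    (h : Valid x.height (n : Ordinal.{u}))
    (h' : Valid x.height ((n + 1 : ℕ) : Ordinal.{u})) :
    ∃ m ∈ belowMonoid α x.height ((n + 1 : ℕ) : Ordinal.{u}),
      exponent (shift x n h) = m + exponent (shift x ((n + 1 : ℕ) : Ordinal.{u}) h') := by
  obtain ⟨γ, hγ⟩ := id hs
  have hlt : γ < x.height := by rw [hγ]; exact Order.lt_add_one_iff.2 le_rfl
  let c : Vertex α := ⟨γ, (shift x n h).seq + Finsupp.single x.height ((1 : ℕ) : Ordinal.{u}),
    hlt.trans x.height_lt, add_single_mem (shift x n h) hγ 1⟩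
  have hseq (k : ℕ) : (shift x ((n + 1 : ℕ) : Ordinal.{u}) h').seq +
      Finsupp.single x.height (k : Ordinal.{u}) =
        (shift x n h).seq + Finsupp.single x.height ((k + 1 : ℕ) : Ordinal.{u}) := by
    rw [shift_seq, shift_seq, add_assoc, add_assoc, ← Finsupp.single_add, ← Finsupp.single_add,
      ← Nat.cast_add, ← Nat.cast_add, add_assoc, add_comm 1 k]
  have hinj {k l : ℕ} (e : (shift x n h).seq + Finsupp.single x.height (k : Ordinal.{u}) =
      (shift x n h).seq + Finsupp.single x.height (l : Ordinal.{u})) : k = l := by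
    have := DFunLike.congr_fun e x.height
    rw [Finsupp.add_apply, Finsupp.add_apply, Finsupp.single_eq_same,
      Finsupp.single_eq_same] at this
    exact_mod_cast add_left_cancel this
  have hc : Below x.height ((n + 1 : ℕ) : Ordinal.{u}) c := by
    refine ⟨hlt, fun _ => ?_, fun hl => absurd hs (not_isSuc_of_isSuccLimit hl)⟩
    change ((shift x n h).seq + Finsupp.single x.height ((1 : ℕ) : Ordinal.{u})) x.height ≤ _
    rw [Finsupp.add_apply, shift_seq_height, Finsupp.single_eq_same, ← Nat.cast_add]
  refine ⟨exponent c + exponent c, add_mem (exponent_mem_belowMonoid hc)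
    (exponent_mem_belowMonoid hc), exponent_eq_add_of_edge_iff hs.ne_zero hs.ne_zero ?_ ?_⟩
  · rw [edge_iff_of_succ (show IsSuc (shift x ((n + 1 : ℕ) : Ordinal.{u}) h').height from hs)]
    rintro ⟨-, k, hk, e⟩
    rw [shift_height, hseq] at e
    have := hinj e
    omega
  · intro y
    rw [edge_iff_of_succ (show IsSuc (shift x ((n + 1 : ℕ) : Ordinal.{u}) h').height from hs),
      edge_iff_of_succ (show IsSuc (shift x n h).height from hs)]
    simp only [shift_height, hseq]
    constructor
    · rintro ⟨e, k, hk, hy⟩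
      obtain rfl | ⟨k, rfl⟩ : k = 1 ∨ ∃ j, k = j + 1 + 1 := by
        rcases k with _ | _ | k
        · omega
        · exact Or.inl rfl
        · exact Or.inr ⟨k, rfl⟩
      · exact Or.inl (Vertex.ext (Order.add_one_inj.1 (e.symm.trans hγ)) hy)
      · exact Or.inr ⟨e, k + 1, k.succ_pos, hy⟩
    · rintro (rfl | ⟨e, k, hk, hy⟩)
      · exact ⟨hγ, 1, one_pos, rfl⟩
      · exact ⟨e, k + 1, k.succ_pos, hy⟩

/-- Only the squared factor of height `δ + 1` is lost. -/
theorem exponent_shift_add_one (x : Vertex α) (hl : Order.IsSuccLimit x.height)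
    {δ : Ordinal.{u}} (h : Valid x.height δ) (h' : Valid x.height (δ + 1)) :
    ∃ m ∈ belowMonoid α x.height (δ + 1),
      exponent (shift x δ h) = m + exponent (shift x (δ + 1) h') := by
  classical
  have hlt : δ + 1 < x.height := by
    rcases h' with ⟨h0, -⟩ | ⟨h0, -⟩ | ⟨-, h'⟩
    · exact absurd h0 hl.bot_lt.ne'
    · exact absurd h0 (not_isSuc_of_isSuccLimit hl)
    · exact h'
  let c : Vertex α := ⟨δ + 1, tau x.height x.seq, hlt.trans x.height_lt,
    tau_mem_of_le x hlt.le⟩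
  have hc : Below x.height (δ + 1) c := by
    refine ⟨hlt, fun hs => absurd hs (not_isSuc_of_isSuccLimit hl), fun _ => ⟨le_rfl, ?_⟩⟩
    intro ε _ h2
    exact (tau_apply _ _ _).trans (if_neg h2.not_gt)
  refine ⟨exponent c + exponent c, add_mem (exponent_mem_belowMonoid hc)
    (exponent_mem_belowMonoid hc), exponent_eq_add_of_edge_iff hl.bot_lt.ne' hl.bot_lt.ne' ?_ ?_⟩
  · rw [edge_iff_of_isSuccLimit (show Order.IsSuccLimit (shift x (δ + 1) h').height from hl),
      shift_height, shift_seq_height]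
    exact fun h => lt_irrefl _ h.2.2.1
  · intro y
    rw [edge_iff_of_isSuccLimit (show Order.IsSuccLimit (shift x (δ + 1) h').height from hl),
      edge_iff_of_isSuccLimit (show Order.IsSuccLimit (shift x δ h).height from hl),
      shift_height, shift_height, shift_seq_height, shift_seq_height, tau_shift, tau_shift]
    constructor
    · rintro ⟨h1, h2, h3, h4⟩
      rcases (Order.add_one_le_of_lt h3).eq_or_lt with e | e
      · exact Or.inl (Vertex.ext e.symm h4)
      · exact Or.inr ⟨h1, h2, e, h4⟩
    · rintro (rfl | ⟨h1, h2, h3, h4⟩)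
      · exact ⟨isSuc_add_one δ, hlt, Order.lt_add_one_iff.2 le_rfl, rfl⟩
      · exact ⟨h1, h2, (Order.lt_add_one_iff.2 le_rfl).trans h3, h4⟩

/-- The factors of height strictly between `δ` and `δ'` multiply to one vertex `c` of height `δ'`.
No factor has height exactly `δ'`, as a limit is not a successor. -/
theorem exponent_shift_isSuccLimit (x : Vertex α) (hl : Order.IsSuccLimit x.height)
    {δ δ' : Ordinal.{u}} (h : Valid x.height δ) (h' : Valid x.height δ')
    (hl' : Order.IsSuccLimit δ') (hlt : δ < δ') :
    ∃ m ∈ belowMonoid α x.height δ', exponent (shift x δ h) = m + exponent (shift x δ' h') := by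
  classical
  have hlt' : δ' < x.height := by
    rcases h' with ⟨h0, -⟩ | ⟨h0, -⟩ | ⟨-, h'⟩
    · exact absurd h0 hl.bot_lt.ne'
    · exact absurd h0 (not_isSuc_of_isSuccLimit hl)
    · exact h'
  let b : Vertex α := ⟨δ', tau x.height x.seq, hlt'.trans x.height_lt, tau_mem_of_le x hlt'.le⟩
  have hbv : Valid b.height δ := Or.inr (Or.inr ⟨hl', hlt⟩)
  have htb : tau b.height b.seq = tau x.height x.seq := by
    ext ε
    change tau δ' (tau x.height x.seq) ε = _
    rw [tau_apply, tau_apply]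
    split_ifs with h1 h2 h2
    · rfl
    · rfl
    · exact absurd (hlt'.trans h2) h1
    · rfl
  let c := shift b δ hbv
  have hc : Below x.height δ' c := by
    refine ⟨hlt', fun hs => absurd hs (not_isSuc_of_isSuccLimit hl), fun _ => ⟨le_rfl, ?_⟩⟩
    intro ε h1 h2
    rw [shift_seq_apply, if_pos h1]
    exact (tau_apply _ _ _).trans (if_neg h2.not_gt)
  refine ⟨exponent c, exponent_mem_belowMonoid hc,
    exponent_eq_add_of_edge_iff_or hl.bot_lt.ne' hl.bot_lt.ne' hl'.bot_lt.ne' ?_ ?_⟩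
  all_goals
    intro y
    rw [edge_iff_of_isSuccLimit (show Order.IsSuccLimit (shift x δ' h').height from hl),
      edge_iff_of_isSuccLimit (show Order.IsSuccLimit c.height from hl'),
      shift_height, shift_height, shift_seq_height, shift_seq_height, tau_shift, tau_shift, htb]
  · exact fun h1 h2 => lt_asymm h1.2.1 h2.2.2.1
  · rw [edge_iff_of_isSuccLimit (show Order.IsSuccLimit (shift x δ h).height from hl),
      shift_height, shift_seq_height, tau_shift]
    constructor
    · rintro ⟨h1, h2, h3, h4⟩
      rcases lt_trichotomy y.height δ' with e | e | e
      · exact Or.inl ⟨h1, e, h3, h4⟩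
      · exact absurd (e ▸ h1) (not_isSuc_of_isSuccLimit hl')
      · exact Or.inr ⟨h1, h2, e, h4⟩
    · rintro (⟨h1, h2, h3, h4⟩ | ⟨h1, h2, h3, h4⟩)
      · exact ⟨h1, h2.trans hlt', h3, h4⟩
      · exact ⟨h1, h2, hlt.trans h3, h4⟩

/-- `shift x δ` is the product of `shift x δ'` and of vertices below it. -/
theorem exponent_shift_of_le (x : Vertex α) {δ δ' : Ordinal.{u}} (h : Valid x.height δ)
    (h' : Valid x.height δ') (hle : δ ≤ δ') :
    ∃ m ∈ belowMonoid α x.height δ', exponent (shift x δ h) = m + exponent (shift x δ' h') := by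
  have trans {δ δ' δ'' : Ordinal.{u}} {h : Valid x.height δ} (h' : Valid x.height δ')
      {h'' : Valid x.height δ''} (hle : δ' ≤ δ'')
      (a : ∃ m ∈ belowMonoid α x.height δ', exponent (shift x δ h) = m + exponent (shift x δ' h'))
      (b : ∃ m ∈ belowMonoid α x.height δ'',
        exponent (shift x δ' h') = m + exponent (shift x δ'' h'')) :
      ∃ m ∈ belowMonoid α x.height δ'', exponent (shift x δ h) = m + exponent (shift x δ'' h'') := by
    obtain ⟨m, hm, e⟩ := a
    obtain ⟨m', hm', e'⟩ := b
    exact ⟨m + m', add_mem (belowMonoid_mono _ hle hm) hm', by rw [e, e', add_assoc]⟩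
  rcases hle.eq_or_lt with rfl | hlt
  · exact ⟨0, zero_mem _, by rw [zero_add]⟩
  rcases id h' with ⟨-, hδ⟩ | ⟨hs, hδ⟩ | ⟨hl, -⟩
  · exact absurd hlt (by simp [hδ])
  · obtain ⟨n', rfl⟩ := Ordinal.lt_omega0.1 hδ
    obtain ⟨n, rfl⟩ := Ordinal.lt_omega0.1 (hlt.trans hδ)
    have hn : n ≤ n' := by exact_mod_cast hle
    clear hlt hle hδ
    induction n', hn using Nat.le_induction with
    | base => exact ⟨0, zero_mem _, by rw [zero_add]⟩
    | succ k _ ih =>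
      have hk : Valid x.height (k : Ordinal.{u}) :=
        Or.inr (Or.inl ⟨hs, Ordinal.natCast_lt_omega0 k⟩)
      exact trans hk (by exact_mod_cast k.le_succ) (ih hk) (exponent_shift_natCast x hs k hk h')
  · induction δ' using Ordinal.limitRecOn with
    | zero => exact absurd hlt (by simp)
    | add_one ε ih =>
      have hε : ε < ε + 1 := Order.lt_add_one_iff.2 le_rfl
      have hv : Valid x.height ε := by
        rcases h' with ⟨h0, -⟩ | ⟨h0, -⟩ | ⟨-, h'⟩
        · exact absurd h0 hl.bot_lt.ne'
        · exact absurd h0 (not_isSuc_of_isSuccLimit hl)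
        · exact Or.inr (Or.inr ⟨hl, hε.trans h'⟩)
      rcases (Order.lt_add_one_iff.1 hlt).eq_or_lt with rfl | hlt'
      · exact exponent_shift_add_one x hl h h'
      · exact trans hv hε.le (ih hv hlt'.le hlt') (exponent_shift_add_one x hl hv h')
    -- No induction hypothesis is needed: a limit is reached from any smaller `δ` in one step.
    | limit δ' hl' _ => exact exponent_shift_isSuccLimit x hl h h' hl' hlt

theorem exponent_mem_monomials (x : Vertex α) : exponent x ∈ monomials α :=
  AddSubmonoid.subset_closure ⟨x, rfl⟩

theorem belowMonoid_le (β δ : Ordinal.{u}) : belowMonoid α β δ ≤ monomials α :=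
  AddSubmonoid.closure_mono (Set.image_subset_range _ _)


/-! ### Greatest common divisors of families of exponents. -/

theorem ExpDisjoint.symm {m n : U α 0 → ℕ} (h : ExpDisjoint m n) : ExpDisjoint n m :=
  fun r => (h r).symm

theorem ExpDisjoint.add_left {m m' n : U α 0 → ℕ} (h : ExpDisjoint m n)
    (h' : ExpDisjoint m' n) : ExpDisjoint (m + m') n := by
  intro r
  have h1 := h r
  have h2 := h' r
  rw [Pi.add_apply]
  omega

theorem ExpDisjoint.of_add_right {m n n' : U α 0 → ℕ} (h : ExpDisjoint m (n + n')) :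
    ExpDisjoint m n' := by
  intro r
  have h1 := h r
  rw [Pi.add_apply] at h1
  omega

theorem expDisjoint_closure_left {S : Set (U α 0 → ℕ)} {n : U α 0 → ℕ}
    (h : ∀ m ∈ S, ExpDisjoint m n) : ∀ m ∈ AddSubmonoid.closure S, ExpDisjoint m n :=
  fun _ hm => AddSubmonoid.closure_induction h (fun _ => Or.inl rfl)
    (fun _ _ _ _ h1 h2 => h1.add_left h2) hm

theorem expDisjoint_closure {S T : Set (U α 0 → ℕ)}
    (h : ∀ m ∈ S, ∀ n ∈ T, ExpDisjoint m n) :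
    ∀ m ∈ AddSubmonoid.closure S, ∀ n ∈ AddSubmonoid.closure T, ExpDisjoint m n :=
  fun _ hm _ hn => expDisjoint_closure_left (fun m hm =>
    (expDisjoint_closure_left (fun n hn => (h m hm n hn).symm) _ hn).symm) _ hm

/-- `m` and `n` have a greatest common divisor, their pointwise minimum, in the monoid `N`. -/
def HasGcd (N : AddSubmonoid (U α 0 → ℕ)) (m n : U α 0 → ℕ) : Prop :=
  ∃ g ∈ N, ∃ m' ∈ N, ∃ n' ∈ N, m = g + m' ∧ n = g + n' ∧ ExpDisjoint m' n'

theorem HasGcd.mono {N N' : AddSubmonoid (U α 0 → ℕ)} (h : N ≤ N') {m n : U α 0 → ℕ}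
    (hmn : HasGcd N m n) : HasGcd N' m n := by
  obtain ⟨g, hg, m', hm', n', hn', e⟩ := hmn
  exact ⟨g, h hg, m', h hm', n', h hn', e⟩

theorem hasGcd_of_expDisjoint {N : AddSubmonoid (U α 0 → ℕ)} {m n : U α 0 → ℕ} (hm : m ∈ N)
    (hn : n ∈ N) (h : ExpDisjoint m n) : HasGcd N m n :=
  ⟨0, zero_mem _, m, hm, n, hn, (zero_add m).symm, (zero_add n).symm, h⟩

/-- Take the gcd of `m₁` and `n` first, then that of `m₂` and the remaining cofactor of `n`. -/
theorem HasGcd.add_left {N : AddSubmonoid (U α 0 → ℕ)} {m₁ m₂ n : U α 0 → ℕ}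
    (h₁ : HasGcd N m₁ n) (h₂ : ∀ n ∈ N, HasGcd N m₂ n) : HasGcd N (m₁ + m₂) n := by
  obtain ⟨g, hg, m', hm', n', hn', rfl, rfl, hc⟩ := h₁
  obtain ⟨g₂, hg₂, m₂', hm₂', n₂', hn₂', rfl, rfl, hc₂⟩ := h₂ n' hn'
  exact ⟨g + g₂, add_mem hg hg₂, m' + m₂', add_mem hm' hm₂', n₂', hn₂',
    add_add_add_comm _ _ _ _, (add_assoc _ _ _).symm, hc.of_add_right.add_left hc₂⟩

/-- Greatest common divisors of products of mutually disjoint factors. -/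
theorem HasGcd.add {N : AddSubmonoid (U α 0 → ℕ)} {m₁ m₂ n₁ n₂ : U α 0 → ℕ}
    (h₁ : HasGcd N m₁ n₁) (h₂ : HasGcd N m₂ n₂) (h₁₂ : ExpDisjoint m₁ n₂)
    (h₂₁ : ExpDisjoint m₂ n₁) : HasGcd N (m₁ + m₂) (n₁ + n₂) := by
  obtain ⟨g, hg, a, ha, b, hb, rfl, rfl, hc⟩ := h₁
  obtain ⟨g', hg', a', ha', b', hb', rfl, rfl, hc'⟩ := h₂
  refine ⟨g + g', add_mem hg hg', a + a', add_mem ha ha', b + b', add_mem hb hb',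
    add_add_add_comm _ _ _ _, add_add_add_comm _ _ _ _, fun r => ?_⟩
  have e1 := hc r
  have e2 := hc' r
  have e3 := h₁₂ r
  have e4 := h₂₁ r
  simp only [Pi.add_apply] at e1 e2 e3 e4 ⊢
  omega

theorem hasGcd_closure {T : Set (U α 0 → ℕ)}
    (hT : ∀ x ∈ T, ∀ y ∈ T, x = y ∨ ExpDisjoint x y) :
    ∀ m ∈ AddSubmonoid.closure T, ∀ n ∈ AddSubmonoid.closure T,
      HasGcd (AddSubmonoid.closure T) m n := by
  intro m hm
  induction hm using AddSubmonoid.closure_induction with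
  | mem x hx =>
    intro n hn
    -- A generator behaves like a prime: it divides `n` or is disjoint from it.
    have key : (∃ n' ∈ AddSubmonoid.closure T, n = x + n') ∨ ExpDisjoint n x := by
      induction hn using AddSubmonoid.closure_induction with
      | mem y hy =>
        rcases hT x hx y hy with rfl | h
        · exact Or.inl ⟨0, zero_mem _, (add_zero x).symm⟩
        · exact Or.inr h.symm
      | zero => exact Or.inr fun _ => Or.inl rfl
      | add a b ha hb iha ihb =>
        rcases iha with ⟨a', ha', rfl⟩ | iha
        · exact Or.inl ⟨a' + b, add_mem ha' hb, add_assoc _ _ _⟩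
        · rcases ihb with ⟨b', hb', rfl⟩ | ihb
          · exact Or.inl ⟨a + b', add_mem ha hb', add_left_comm _ _ _⟩
          · exact Or.inr (iha.add_left ihb)
    have hx' := AddSubmonoid.subset_closure hx
    rcases key with ⟨n', hn', rfl⟩ | h
    · exact ⟨x, hx', 0, zero_mem _, n', hn', (add_zero x).symm, rfl, fun _ => Or.inl rfl⟩
    · exact hasGcd_of_expDisjoint hx' hn h.symm
  | zero => exact fun n hn => hasGcd_of_expDisjoint (zero_mem _) hn fun _ => Or.inl rfl
  | add a b _ _ iha ihb => exact fun n hn => (iha n hn).add_left ihb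

theorem valid_zero (β : Ordinal.{u}) : Valid β 0 := by
  rcases zero_or_isSuc_or_isSuccLimit β with h | h | h
  · exact Or.inl ⟨h, rfl⟩
  · exact Or.inr (Or.inl ⟨h, Ordinal.omega0_pos⟩)
  · exact Or.inr (Or.inr ⟨h, h.bot_lt⟩)

/-! ### Splitting monomials by height, and their gcds. -/

/-- The vertices `X_{β,t}` with `t_β = δ`. -/
def levelSet (α β δ : Ordinal.{u}) : Set (Vertex α) := {x | x.height = β ∧ x.seq β = δ}

theorem shift_eq_of_mem_levelSet {x : Vertex α} {β δ : Ordinal.{u}} (h : x ∈ levelSet α β δ) :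
    ∃ hv, shift x δ hv = x := by
  obtain ⟨rfl, rfl⟩ := h
  exact ⟨_, shift_self x⟩

theorem eq_or_expDisjoint_of_mem_levelSet {x y : Vertex α} {β δ : Ordinal.{u}}
    (hx : x ∈ levelSet α β δ) (hy : y ∈ levelSet α β δ) :
    x = y ∨ ExpDisjoint (exponent x) (exponent y) := by
  by_cases h : tau x.height x.seq = tau y.height y.seq
  · obtain ⟨hxv, ex⟩ := shift_eq_of_mem_levelSet hx
    obtain ⟨hyv, ey⟩ := shift_eq_of_mem_levelSet hy
    left
    rw [← ex, ← ey]
    exact Vertex.ext (hx.1.trans hy.1.symm) (by rw [shift_seq, shift_seq, h, hx.1, hy.1])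
  · exact Or.inr (expDisjoint_of_tau_ne (hx.1.trans hy.1.symm) h)

theorem expDisjoint_of_mem_levelSet_of_below {x y : Vertex α} {β δ : Ordinal.{u}}
    (hx : x ∈ levelSet α β δ) (hy : Below β δ y) : ExpDisjoint (exponent x) (exponent y) := by
  obtain ⟨hv, ex⟩ := shift_eq_of_mem_levelSet hx
  rw [← ex]
  exact (Below.expDisjoint hv (hx.1 ▸ hy)).symm

/-- The monoid generated by the vertices of height at most `β`. -/
noncomputable def monomialsLE (α β : Ordinal.{u}) : AddSubmonoid (U α 0 → ℕ) :=
  AddSubmonoid.closure (exponent '' {y : Vertex α | y.height ≤ β})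

theorem monomialsLE_mono {β γ : Ordinal.{u}} (h : β ≤ γ) :
    monomialsLE α β ≤ monomialsLE α γ :=
  AddSubmonoid.closure_mono (Set.image_mono fun _ hy => le_trans hy h)

/-- Finitely many factors have a maximal height; the empty product is separate because `β` may be
`0`. -/
theorem eq_zero_or_exists_mem_monomialsLE {β : Ordinal.{u}} {m : U α 0 → ℕ}
    (hm : m ∈ AddSubmonoid.closure (exponent '' {y : Vertex α | y.height < β})) :
    m = 0 ∨ ∃ γ < β, m ∈ monomialsLE α γ := by
  induction hm using AddSubmonoid.closure_induction with
  | mem m hm =>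
    obtain ⟨y, hy, rfl⟩ := hm
    exact Or.inr ⟨y.height, hy, AddSubmonoid.subset_closure ⟨y, le_refl y.height, rfl⟩⟩
  | zero => exact Or.inl rfl
  | add a b _ _ iha ihb =>
    rcases iha with rfl | ⟨γ, hγ, ha⟩
    · rwa [zero_add]
    rcases ihb with rfl | ⟨γ', hγ', hb⟩
    · rw [add_zero]; exact Or.inr ⟨γ, hγ, ha⟩
    · exact Or.inr ⟨max γ γ', max_lt hγ hγ', add_mem (monomialsLE_mono (le_max_left _ _) ha)
        (monomialsLE_mono (le_max_right _ _) hb)⟩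

/-- A product of vertices of height at most `β` splits, for all large `δ`, into vertices
`X_{β,t}` with `t_β = δ` and vertices below them. -/
theorem exists_split {β : Ordinal.{u}} {m : U α 0 → ℕ} (hm : m ∈ monomialsLE α β) :
    ∃ δ₀, Valid β δ₀ ∧ ∀ δ, δ₀ ≤ δ → Valid β δ →
      ∃ a ∈ AddSubmonoid.closure (exponent '' levelSet α β δ), ∃ b ∈ belowMonoid α β δ,
        m = a + b := by
  induction hm using AddSubmonoid.closure_induction with
  | mem m hm =>
    obtain ⟨y, hy, rfl⟩ := hm
    rcases (show y.height ≤ β from hy).eq_or_lt with rfl | h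
    · refine ⟨_, valid_seq y, fun δ hle hδ => ?_⟩
      obtain ⟨b, hb, e⟩ := exponent_shift_of_le y (valid_seq y) hδ hle
      rw [shift_self] at e
      exact ⟨_, AddSubmonoid.subset_closure ⟨shift y δ hδ, ⟨rfl, shift_seq_height y hδ⟩, rfl⟩, b,
        hb, e.trans (add_comm _ _)⟩
    · obtain ⟨δ₀, hδ₀, hb⟩ := exists_below h
      exact ⟨δ₀, hδ₀, fun δ hle _ => ⟨0, zero_mem _, _,
        exponent_mem_belowMonoid (hb.mono hle), (zero_add _).symm⟩⟩
  | zero => exact ⟨0, valid_zero β, fun _ _ _ => ⟨0, zero_mem _, 0, zero_mem _, rfl⟩⟩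
  | add m n _ _ ihm ihn =>
    obtain ⟨δ₁, hδ₁, h₁⟩ := ihm
    obtain ⟨δ₂, hδ₂, h₂⟩ := ihn
    refine ⟨max δ₁ δ₂, hδ₁.max hδ₂, fun δ hle hδ => ?_⟩
    obtain ⟨a, ha, b, hb, rfl⟩ := h₁ δ ((le_max_left _ _).trans hle) hδ
    obtain ⟨a', ha', b', hb', rfl⟩ := h₂ δ ((le_max_right _ _).trans hle) hδ
    exact ⟨a + a', add_mem ha ha', b + b', add_mem hb hb', add_add_add_comm _ _ _ _⟩

/-- Both products are split at a common `δ`. The top parts and the lower parts are mutually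
disjoint, so their gcds can be taken separately, the lower one by induction on `β`. -/
theorem hasGcd_monomialsLE (β : Ordinal.{u}) :
    ∀ m ∈ monomialsLE α β, ∀ n ∈ monomialsLE α β, HasGcd (monomialsLE α β) m n := by
  induction β using WellFoundedLT.induction with
  | ind β ih =>
    intro m hm n hn
    obtain ⟨δ₁, hδ₁, h₁⟩ := exists_split hm
    obtain ⟨δ₂, hδ₂, h₂⟩ := exists_split hn
    obtain ⟨a, ha, b, hb, rfl⟩ := h₁ _ (le_max_left _ _) (hδ₁.max hδ₂)
    obtain ⟨a', ha', b', hb', rfl⟩ := h₂ _ (le_max_right _ _) (hδ₁.max hδ₂)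
    have hdisj := expDisjoint_closure (S := exponent '' levelSet α β (max δ₁ δ₂))
      (T := exponent '' {y | Below β (max δ₁ δ₂) y}) (by
        rintro _ ⟨x, hx, rfl⟩ _ ⟨y, hy, rfl⟩
        exact expDisjoint_of_mem_levelSet_of_below hx hy)
    have hlevel : AddSubmonoid.closure (exponent '' levelSet α β (max δ₁ δ₂)) ≤
        monomialsLE α β := AddSubmonoid.closure_mono (Set.image_mono fun _ hy => hy.1.le)
    have hbelow : belowMonoid α β (max δ₁ δ₂) ≤
        AddSubmonoid.closure (exponent '' {y : Vertex α | y.height < β}) :=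
      AddSubmonoid.closure_mono (Set.image_mono fun _ hy => hy.1)
    have hlt : AddSubmonoid.closure (exponent '' {y : Vertex α | y.height < β}) ≤
        monomialsLE α β :=
      AddSubmonoid.closure_mono (Set.image_mono fun y (hy : y.height < β) => hy.le)
    refine HasGcd.add ?_ ?_ (hdisj _ ha _ hb') (hdisj _ ha' _ hb).symm
    · refine (hasGcd_closure ?_ a ha a' ha').mono hlevel
      rintro _ ⟨x, hx, rfl⟩ _ ⟨y, hy, rfl⟩
      exact (eq_or_expDisjoint_of_mem_levelSet hx hy).imp_left fun h => by rw [h]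
    · rcases eq_zero_or_exists_mem_monomialsLE (hbelow hb) with rfl | ⟨γ, hγ, hbγ⟩
      · exact hasGcd_of_expDisjoint (zero_mem _) (hlt (hbelow hb')) fun _ => Or.inl rfl
      rcases eq_zero_or_exists_mem_monomialsLE (hbelow hb') with rfl | ⟨γ', hγ', hbγ'⟩
      · exact hasGcd_of_expDisjoint (hlt (hbelow hb)) (zero_mem _) fun _ => Or.inr rfl
      · have hmax := max_lt hγ hγ'
        exact (ih _ hmax b (monomialsLE_mono (le_max_left _ _) hbγ) b'
          (monomialsLE_mono (le_max_right _ _) hbγ')).mono (monomialsLE_mono hmax.le)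

theorem monomials_eq_monomialsLE (α : Ordinal.{u}) : monomials α = monomialsLE α α := by
  have : {y : Vertex α | y.height ≤ α} = Set.univ :=
    Set.eq_univ_of_forall fun y => y.height_lt.le
  rw [monomials, monomialsLE, this, Set.image_univ]

/-- Any two monomials have a greatest common divisor, their pointwise minimum. -/
theorem hasGcd_monomials {m n : U α 0 → ℕ} (hm : m ∈ monomials α) (hn : n ∈ monomials α) :
    HasGcd (monomials α) m n := by
  rw [monomials_eq_monomialsLE] at *
  exact hasGcd_monomialsLE α m hm n hn

/-- A vertex, shifted far enough, divides a given monomial or is disjoint to it. -/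
theorem exists_shift_dvd_or_expDisjoint (x : Vertex α) {m : U α 0 → ℕ} (hm : m ∈ monomials α) :
    ∃ δ h, (∃ n ∈ monomials α, m = exponent (shift x δ h) + n) ∨
      ExpDisjoint m (exponent (shift x δ h)) := by
  have hadd {m m' : U α 0 → ℕ} (hm : m ∈ monomials α) (hm' : m' ∈ monomials α)
      (h₁ : ∃ δ h, (∃ n ∈ monomials α, m = exponent (shift x δ h) + n) ∨
        ExpDisjoint m (exponent (shift x δ h)))
      (h₂ : ∃ δ h, (∃ n ∈ monomials α, m' = exponent (shift x δ h) + n) ∨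
        ExpDisjoint m' (exponent (shift x δ h))) :
      ∃ δ h, (∃ n ∈ monomials α, m + m' = exponent (shift x δ h) + n) ∨
        ExpDisjoint (m + m') (exponent (shift x δ h)) := by
    obtain ⟨δ₁, hδ₁, ⟨n, hn, rfl⟩ | h₁⟩ := h₁
    · exact ⟨δ₁, hδ₁, Or.inl ⟨n + m', add_mem hn hm', add_assoc _ _ _⟩⟩
    obtain ⟨δ₂, hδ₂, ⟨n, hn, rfl⟩ | h₂⟩ := h₂
    · exact ⟨δ₂, hδ₂, Or.inl ⟨m + n, add_mem hm hn, add_left_comm _ _ _⟩⟩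
    -- Disjointness persists at the larger shift, which divides both smaller ones.
    obtain ⟨_, _, e₁⟩ := exponent_shift_of_le x hδ₁ (hδ₁.max hδ₂) (le_max_left _ _)
    obtain ⟨_, _, e₂⟩ := exponent_shift_of_le x hδ₂ (hδ₁.max hδ₂) (le_max_right _ _)
    rw [e₁] at h₁
    rw [e₂] at h₂
    exact ⟨_, hδ₁.max hδ₂, Or.inr (h₁.of_add_right.add_left h₂.of_add_right)⟩
  have hzero : ∃ δ h, (∃ n ∈ monomials α, (0 : U α 0 → ℕ) = exponent (shift x δ h) + n) ∨
        ExpDisjoint 0 (exponent (shift x δ h)) :=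
    ⟨0, valid_zero _, Or.inr fun _ => Or.inl rfl⟩
  have hvertex (β : Ordinal.{u}) : ∀ y : Vertex α, y.height = β →
      ∃ δ h, (∃ n ∈ monomials α, exponent y = exponent (shift x δ h) + n) ∨
        ExpDisjoint (exponent y) (exponent (shift x δ h)) := by
    induction β using WellFoundedLT.induction with
    | ind β ih =>
      rintro y rfl
      rcases lt_trichotomy y.height x.height with h | h | h
      · obtain ⟨δ, hδ, hb⟩ := exists_below h
        exact ⟨δ, hδ, Or.inr (hb.expDisjoint hδ)⟩
      · by_cases ht : tau y.height y.seq = tau x.height x.seq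
        · refine ⟨y.seq y.height, h ▸ valid_seq y, Or.inl ⟨0, zero_mem _, ?_⟩⟩
          rw [add_zero]
          congr 1
          conv_lhs => rw [← shift_self y]
          exact Vertex.ext h (by rw [shift_seq, shift_seq, ht, h])
        · exact ⟨_, valid_seq x, Or.inr (by
            rw [shift_self]; exact expDisjoint_of_tau_ne h ht)⟩
      -- Here `y` is higher than `x`: raise `y` until it is disjoint from `x`. The factors split off
      -- have smaller height than `y`, so induction applies to them.
      · obtain ⟨δ, hδ, hb⟩ := exists_below h
        obtain ⟨m, hm, e⟩ := exponent_shift_of_le y (valid_seq y) ((valid_seq y).max hδ)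
          (le_max_left _ _)
        rw [shift_self] at e
        rw [e]
        refine hadd (belowMonoid_le _ _ hm) (exponent_mem_monomials _) ?_
          ⟨_, valid_seq x, Or.inr ?_⟩
        · refine AddSubmonoid.closure_induction ?_ hzero (fun a b ha hb => ?_) hm
          · rintro _ ⟨c, hc, rfl⟩
            exact ih _ hc.1 c rfl
          · exact hadd (belowMonoid_le _ _ ha) (belowMonoid_le _ _ hb)
        · rw [shift_self]
          exact ((hb.mono (le_max_right _ _)).expDisjoint _).symm
  induction hm using AddSubmonoid.closure_induction with
  | mem m hm =>
    obtain ⟨y, rfl⟩ := hm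
    exact hvertex _ y rfl
  | zero => exact hzero
  | add a b ha hb iha ihb => exact hadd ha hb iha ihb

theorem Edge.exponent_le {x y : Vertex α} (h : Edge x y) (r : U α 0) :
    exponent y r ≤ exponent x r := by
  have hx : x.height ≠ 0 := (zero_le.trans_lt h.height_lt).ne'
  have hfin := finite_edge_inter_support x r
  rw [← Set.insert_sdiff_self_of_mem (show y ∈ {y | Edge x y} from h)] at hfin
  rw [exponent_of_height_ne_zero hx,
    ← Set.insert_sdiff_self_of_mem (show y ∈ {y | Edge x y} from h),
    finsum_mem_insert' _ (fun h => h.2 rfl)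
      (hfin.subset (Set.inter_subset_inter_left _ (Set.subset_insert _ _)))]
  omega

theorem exists_edge {x : Vertex α} (hx : x.height ≠ 0) : ∃ y, Edge x y := by
  rcases zero_or_isSuc_or_isSuccLimit x.height with h | ⟨γ, h⟩ | h
  · exact absurd h hx
  · have hlt : γ < x.height := by rw [h]; exact Order.lt_add_one_iff.2 le_rfl
    exact ⟨⟨γ, _, hlt.trans x.height_lt, add_single_mem x h 1⟩, Or.inl ⟨h, 1, one_pos, rfl⟩⟩
  · have hlt : x.seq x.height + 1 < x.height := h.add_one_lt (x.seq_mem.2.2.2.2 h)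
    exact ⟨⟨_, _, hlt.trans x.height_lt, tau_mem x hlt (isSuc_add_one _)⟩,
      Or.inr ⟨h, isSuc_add_one _, hlt, Order.lt_add_one_iff.2 le_rfl, rfl⟩⟩

theorem exponent_vertex_ne_zero (x : Vertex α) : exponent x ≠ 0 := by
  suffices ∀ β : Ordinal.{u}, ∀ x : Vertex α, x.height = β → exponent x ≠ 0 from this _ x rfl
  intro β
  induction β using WellFoundedLT.induction with
  | ind β ih =>
    rintro x rfl h
    by_cases hx : x.height = 0
    · obtain ⟨b, s, hb, hs⟩ := x
      obtain rfl : b = 0 := hx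
      have := congr_fun h ⟨s, hs⟩
      rw [exponent, if_pos rfl, if_pos rfl] at this
      exact one_ne_zero this
    · obtain ⟨y, hy⟩ := exists_edge hx
      refine ih _ hy.height_lt y rfl (funext fun r => ?_)
      have := hy.exponent_le r
      rw [h] at this
      exact Nat.le_zero.1 this

end Combinatorics

/-! ### Monomial content in `F[𝐗]` and the set `S`. -/

section Algebra

variable {α : Ordinal.{u}} {F : Type v} [Field F]

open AddMonoidAlgebra

instance : UniqueSums (monomials α) :=
  UniqueSums.of_injective_addHom (monomials α).subtype.toAddHom Subtype.val_injective
    inferInstance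

instance : IsDomain (PolyX α F) := NoZeroDivisors.to_isDomain _

/-- Iterated gcds; the second clause says that the gcd is the pointwise minimum, attained at each
`r`. -/
theorem exists_gcd_finset {s : Finset (monomials α)} (hs : s.Nonempty) :
    ∃ g : monomials α, (∀ n ∈ s, ∃ n', n = g + n') ∧
      ∀ r, ∃ n ∈ s, (n : U α 0 → ℕ) r = (g : U α 0 → ℕ) r := by
  classical
  induction hs using Finset.Nonempty.cons_induction with
  | singleton a => exact ⟨a, by simp, by simp⟩
  | cons a s _ _ ih =>
    obtain ⟨⟨g, hg⟩, hdvd, hmin⟩ := ih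
    obtain ⟨a, ha⟩ := a
    obtain ⟨h, hh, g', hg', a', ha', rfl, rfl, hc⟩ := hasGcd_monomials hg ha
    refine ⟨⟨h, hh⟩, ?_, fun r => ?_⟩
    · intro n hn
      rcases Finset.mem_cons.1 hn with rfl | hn
      · exact ⟨⟨a', ha'⟩, rfl⟩
      · obtain ⟨n', rfl⟩ := hdvd n hn
        exact ⟨⟨g', hg'⟩ + n', by rw [← add_assoc]; rfl⟩
    · rcases hc r with e | e
      · obtain ⟨n, hn, en⟩ := hmin r
        exact ⟨n, Finset.mem_cons_of_mem hn, by
          rw [en]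
          change (h + g') r = h r
          rw [Pi.add_apply, e, add_zero]⟩
      · exact ⟨_, Finset.mem_cons_self _ _, by
          change (h + a') r = h r
          rw [Pi.add_apply, e, add_zero]⟩

theorem single_dvd_of_forall {f : PolyX α F} {g : monomials α}
    (h : ∀ n ∈ f.coeff.support, ∃ n', n = g + n') :
    (single g (1 : F) : PolyX α F) ∣ f := by
  have hf : f = ∑ n ∈ f.coeff.support, single n (f.coeff n) := by
    refine AddMonoidAlgebra.ext ?_
    rw [coeff_sum]
    exact f.coeff.sum_single.symm
  rw [hf]
  refine Finset.dvd_sum fun n hn => ?_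
  obtain ⟨n', hn'⟩ := h n hn
  exact ⟨single n' (f.coeff n), by rw [single_mul_single, one_mul, ← hn']⟩

theorem exists_of_single_dvd {f : PolyX α F} {g : monomials α}
    (h : (single g (1 : F) : PolyX α F) ∣ f) :
    ∀ n ∈ f.coeff.support, ∃ n', n = g + n' := by
  classical
  obtain ⟨q, rfl⟩ := h
  intro n hn
  obtain ⟨n', -, e⟩ := Finset.mem_image.1 (support_coeff_single_mul_subset q (1 : F) g hn)
  exact ⟨n', e.symm⟩

/-- The gcd of the support is its pointwise minimum, so no proper monomial divides `f` exactly when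
this minimum vanishes everywhere. Membership in `S` thus becomes a condition on each `r` separately.
-/
theorem mem_setS_iff {f : PolyX α F} :
    f ∈ setS α F ↔ f ≠ 0 ∧ ∀ r, ∃ n ∈ f.coeff.support, (n : U α 0 → ℕ) r = 0 := by
  refine and_congr_right fun hf => ⟨fun h r => ?_, fun h m hm hdvd => hm ?_⟩
  · obtain ⟨g, hdvd, hmin⟩ := exists_gcd_finset
      (Finsupp.support_nonempty_iff.2 (coeff_eq_zero.not.2 hf))
    obtain ⟨n, hn, e⟩ := hmin r
    have : g = 0 := by
      by_contra hg
      exact h g hg (single_dvd_of_forall hdvd)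
    exact ⟨n, hn, by rw [e, this]; rfl⟩
  · refine Subtype.ext (funext fun r => ?_)
    obtain ⟨n, hn, e⟩ := h r
    obtain ⟨n', rfl⟩ := exists_of_single_dvd hdvd n hn
    exact (Nat.add_eq_zero_iff.1 e).1

theorem exists_eq_single_mul {f : PolyX α F} (hf : f ≠ 0) :
    ∃ g : monomials α, ∃ q ∈ setS α F, f = single g (1 : F) * q := by
  obtain ⟨g, hdvd, hmin⟩ := exists_gcd_finset
    (Finsupp.support_nonempty_iff.2 (coeff_eq_zero.not.2 hf))
  obtain ⟨q, rfl⟩ := single_dvd_of_forall hdvd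
  refine ⟨g, q, ⟨right_ne_zero_of_mul hf, fun m hm hq => hm ?_⟩, rfl⟩
  refine Subtype.ext (funext fun r => ?_)
  obtain ⟨n, hn, e⟩ := hmin r
  have hdvd' : (single (g + m) (1 : F) : PolyX α F) ∣ single g (1 : F) * q := by
    rw [← one_mul (1 : F), ← single_mul_single, one_mul]
    exact mul_dvd_mul_left _ hq
  obtain ⟨n', rfl⟩ := exists_of_single_dvd hdvd' n hn
  change (g : U α 0 → ℕ) r + (m : U α 0 → ℕ) r + (n' : U α 0 → ℕ) r = _ at e
  change (m : U α 0 → ℕ) r = 0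
  omega

variable (F) in
/-- The specialization `X_{0,r} ↦ 0`. -/
noncomputable def specialize (r : U α 0) : PolyX α F →ₐ[F] PolyX α F :=
  AddMonoidAlgebra.lift F (PolyX α F) (monomials α)
    { toFun := fun m => if (m.toAdd : U α 0 → ℕ) r = 0 then single m.toAdd 1 else 0
      map_one' := if_pos rfl
      map_mul' := fun m n => by
        by_cases hm : (m.toAdd : U α 0 → ℕ) r = 0 <;>
          by_cases hn : (n.toAdd : U α 0 → ℕ) r = 0 <;>
          simp [hm, hn, single_mul_single] }

theorem coeff_specialize (r : U α 0) (f : PolyX α F) (n : monomials α) :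
    (specialize F r f).coeff n = if (n : U α 0 → ℕ) r = 0 then f.coeff n else 0 := by
  classical
  induction f using AddMonoidAlgebra.induction_linear with
  | zero => simp
  | add f g hf hg =>
    rw [map_add, coeff_add, Finsupp.add_apply, hf, hg, coeff_add, Finsupp.add_apply]
    split_ifs <;> simp
  | single m c =>
    rw [specialize, lift_single]
    by_cases hmn : m = n
    · subst hmn
      by_cases hm : (m : U α 0 → ℕ) r = 0 <;> simp [hm]
    · by_cases hm : (m : U α 0 → ℕ) r = 0 <;> simp [hm, hmn]

theorem specialize_ne_zero_iff (r : U α 0) (f : PolyX α F) :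
    specialize F r f ≠ 0 ↔ ∃ n ∈ f.coeff.support, (n : U α 0 → ℕ) r = 0 := by
  rw [Ne, ← coeff_eq_zero, ← Ne, DFunLike.ne_iff]
  refine exists_congr fun n => ?_
  rw [coeff_specialize, Finsupp.mem_support_iff, and_comm]
  simp

/-- Gauss's lemma: `S` consists of the nonzero elements killed by no specialization `X_{0,r} ↦ 0`,
and each of these is a ring homomorphism into a domain. -/
theorem closure_setS_subset : (Submonoid.closure (setS α F) : Set (PolyX α F)) ⊆ setS α F := by
  intro f hf
  induction hf using Submonoid.closure_induction with
  | mem f hf => exact hf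
  | one =>
    rw [mem_setS_iff]
    exact ⟨one_ne_zero, fun r => (specialize_ne_zero_iff r _).1 (by
      rw [map_one]; exact one_ne_zero)⟩
  | mul f g _ _ hf hg =>
    rw [mem_setS_iff] at *
    refine ⟨mul_ne_zero hf.1 hg.1, fun r => (specialize_ne_zero_iff r _).1 ?_⟩
    rw [map_mul]
    exact mul_ne_zero ((specialize_ne_zero_iff r _).2 (hf.2 r))
      ((specialize_ne_zero_iff r _).2 (hg.2 r))

theorem closure_setS_le_nonZeroDivisors :
    Submonoid.closure (setS α F) ≤ nonZeroDivisors (PolyX α F) :=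
  le_nonZeroDivisors_of_noZeroDivisors fun h => (closure_setS_subset h).1 rfl

instance : IsDomain (DomainD α F) :=
  IsLocalization.isDomain_localization closure_setS_le_nonZeroDivisors

/-! ### Monomials and units in `D`. -/

variable (F) in
/-- A monomial as an element of `D`. -/
noncomputable def monD (m : monomials α) : DomainD α F :=
  algebraMap (PolyX α F) (DomainD α F) (single m (1 : F))

theorem monD_add (m n : monomials α) : monD F (m + n) = monD F m * monD F n := by
  rw [monD, monD, monD, ← map_mul, single_mul_single, one_mul]

theorem monD_zero : monD F (0 : monomials α) = 1 := map_one _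

theorem monD_ne_zero (m : monomials α) : monD F m ≠ 0 := by
  rw [monD, Ne, IsLocalization.to_map_eq_zero_iff _ closure_setS_le_nonZeroDivisors,
    ← coeff_eq_zero]
  simp

theorem isUnit_algebraMap {f : PolyX α F} (hf : f ∈ setS α F) :
    IsUnit (algebraMap (PolyX α F) (DomainD α F) f) :=
  IsLocalization.map_units (DomainD α F)
    (⟨f, Submonoid.subset_closure hf⟩ : Submonoid.closure (setS α F))

/-- Every nonzero element of `D` is associated to a monomial. -/
theorem exists_associated_monD {d : DomainD α F} (hd : d ≠ 0) :
    ∃ m, Associated (monD F m) d := by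
  obtain ⟨f, s, rfl⟩ := IsLocalization.exists_mk'_eq (Submonoid.closure (setS α F)) d
  have hf : f ≠ 0 := by
    rintro rfl
    exact hd (IsLocalization.mk'_zero _)
  obtain ⟨g, q, hq, rfl⟩ := exists_eq_single_mul hf
  have h1 : Associated (monD F g)
      (algebraMap (PolyX α F) (DomainD α F) (single g (1 : F) * q)) := by
    rw [map_mul]
    exact associated_mul_unit_right _ _ (isUnit_algebraMap hq)
  refine ⟨g, h1.trans ?_⟩
  rw [← IsLocalization.mk'_spec (DomainD α F) (single g (1 : F) * q) s]
  exact associated_mul_unit_left _ _ (IsLocalization.map_units _ s)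

/-- An inverse of `m` in `D` would make `m` divide a denominator, which lies in `S`. -/
theorem eq_zero_of_isUnit_monD {m : monomials α} (h : IsUnit (monD F m)) : m = 0 := by
  obtain ⟨d, hd⟩ := h.exists_right_inv
  obtain ⟨f, s, rfl⟩ := IsLocalization.exists_mk'_eq (Submonoid.closure (setS α F)) d
  by_contra hm
  refine (closure_setS_subset s.2).2 m hm ⟨f, ?_⟩
  refine IsLocalization.injective (DomainD α F) closure_setS_le_nonZeroDivisors ?_
  rw [map_mul, ← IsLocalization.mk'_spec (DomainD α F) f s, ← mul_assoc]
  exact (by rw [show algebraMap (PolyX α F) (DomainD α F) (single m 1) = monD F m from rfl, hd,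
    one_mul])

/-- At each `r` one of the two terms has exponent `0`, so the sum lies in `S`. Distinctness excludes
`1 + 1`, which vanishes in characteristic `2`. -/
theorem isUnit_monD_add_monD {m n : monomials α} (hmn : m ≠ n)
    (h : ExpDisjoint (m : U α 0 → ℕ) n) : IsUnit (monD F m + monD F n) := by
  classical
  rw [monD, monD, ← map_add]
  have hm : m ∈ (single m (1 : F) + single n (1 : F) : PolyX α F).coeff.support := by
    simp [hmn.symm]
  have hn : n ∈ (single m (1 : F) + single n (1 : F) : PolyX α F).coeff.support := by
    simp [hmn]
  refine isUnit_algebraMap (mem_setS_iff.2 ⟨fun h0 => by simp [h0] at hm, fun r => ?_⟩)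
  rcases h r with e | e
  exacts [⟨m, hm, e⟩, ⟨n, hn, e⟩]

/-! ### The ideals `M_{β,t}` and the prime spectrum. -/

/-- The vertex `x` as a monomial. -/
noncomputable def vertexMonomial (x : Vertex α) : monomials α :=
  ⟨exponent x, exponent_mem_monomials x⟩

theorem vertexMonomial_ne_zero (x : Vertex α) : vertexMonomial x ≠ 0 :=
  fun h => exponent_vertex_ne_zero x (congr_arg Subtype.val h)

theorem vertexMonomial_shift_of_le (x : Vertex α) {δ δ' : Ordinal.{u}} (h : Valid x.height δ)
    (h' : Valid x.height δ') (hle : δ ≤ δ') :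
    ∃ m : monomials α, (m : U α 0 → ℕ) ∈ belowMonoid α x.height δ' ∧
      vertexMonomial (shift x δ h) = m + vertexMonomial (shift x δ' h') := by
  obtain ⟨m, hm, e⟩ := exponent_shift_of_le x h h' hle
  exact ⟨⟨m, belowMonoid_le _ _ hm⟩, hm, Subtype.ext e⟩

theorem monD_shift_dvd (x : Vertex α) {δ δ' : Ordinal.{u}} (h : Valid x.height δ)
    (h' : Valid x.height δ') (hle : δ ≤ δ') :
    monD F (vertexMonomial (shift x δ' h')) ∣ monD F (vertexMonomial (shift x δ h)) := by
  obtain ⟨m, -, e⟩ := vertexMonomial_shift_of_le x h h' hle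
  rw [e, monD_add]
  exact dvd_mul_left _ _

theorem monD_shift_mem_idealM (x : Vertex α) {δ : Ordinal.{u}} (h : Valid x.height δ) :
    monD F (vertexMonomial (shift x δ h)) ∈ idealM F x :=
  Ideal.subset_span ⟨_, mem_genM_iff.2 ⟨δ, h, rfl⟩, rfl⟩

theorem idealM_le_iff {x : Vertex α} {I : Ideal (DomainD α F)} :
    idealM F x ≤ I ↔ ∀ δ h, monD F (vertexMonomial (shift x δ h)) ∈ I := by
  rw [idealM, Ideal.span_le, Set.image_subset_iff]
  constructor
  · exact fun h δ hδ => h (mem_genM_iff.2 ⟨δ, hδ, rfl⟩)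
  · intro h y hy
    obtain ⟨δ, hδ, rfl⟩ := mem_genM_iff.1 hy
    exact h δ hδ

/-- The generators of `M_{β,t}` are directed by divisibility. -/
theorem exists_shift_dvd_of_mem_idealM {x : Vertex α} {d : DomainD α F}
    (hd : d ∈ idealM F x) : ∃ δ h, monD F (vertexMonomial (shift x δ h)) ∣ d := by
  induction hd using Submodule.span_induction with
  | mem d hd =>
    obtain ⟨y, hy, rfl⟩ := hd
    obtain ⟨δ, hδ, rfl⟩ := mem_genM_iff.1 hy
    exact ⟨δ, hδ, dvd_rfl⟩
  | zero => exact ⟨_, valid_seq x, dvd_zero _⟩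
  | add a b _ _ iha ihb =>
    obtain ⟨δ₁, h₁, hd₁⟩ := iha
    obtain ⟨δ₂, h₂, hd₂⟩ := ihb
    exact ⟨_, h₁.max h₂, dvd_add ((monD_shift_dvd x _ _ (le_max_left _ _)).trans hd₁)
      ((monD_shift_dvd x _ _ (le_max_right _ _)).trans hd₂)⟩
  | smul a b _ ih =>
    obtain ⟨δ, h, hd⟩ := ih
    exact ⟨δ, h, hd.mul_left a⟩

theorem idealM_ne_bot (x : Vertex α) : idealM F x ≠ ⊥ := fun h =>
  monD_ne_zero _ ((Submodule.mem_bot _).1 (h ▸ monD_shift_mem_idealM (F := F) x (valid_seq x)))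

theorem idealM_isMaximal (x : Vertex α) : (idealM F x).IsMaximal := by
  rw [Ideal.isMaximal_iff]
  refine ⟨fun h => ?_, fun J d hJ hd hdJ => ?_⟩
  · obtain ⟨δ, hδ, hdvd⟩ := exists_shift_dvd_of_mem_idealM h
    exact vertexMonomial_ne_zero _ (eq_zero_of_isUnit_monD (isUnit_of_dvd_one hdvd))
  · obtain ⟨m, hm⟩ := exists_associated_monD (F := F) (d := d) (by
      rintro rfl; exact hd (zero_mem _))
    have hmJ : monD F m ∈ J := J.mem_of_dvd hm.symm.dvd hdJ
    -- Either a generator divides `m`, putting `d` into `M_{β,t}`, or `m` plus a generator is a unit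
    -- in `J`.
    obtain ⟨δ, h, ⟨n, hn, e⟩ | hdisj⟩ := exists_shift_dvd_or_expDisjoint x m.2
    · refine absurd (Ideal.mem_of_dvd _ hm.dvd ?_) hd
      rw [show m = vertexMonomial (shift x δ h) + ⟨n, hn⟩ from Subtype.ext e, monD_add]
      exact Ideal.mul_mem_right _ _ (monD_shift_mem_idealM x h)
    · have hne : m ≠ vertexMonomial (shift x δ h) := by
        rintro rfl
        exact exponent_vertex_ne_zero _ (funext fun r => or_self_iff.1 (hdisj r))
      rw [← Ideal.eq_top_iff_one]
      exact Ideal.eq_top_of_isUnit_mem _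
        (add_mem hmJ (hJ (monD_shift_mem_idealM x h))) (isUnit_monD_add_monD hne hdisj)

/-- Used with all vertices, to find one in `P`, and with the vertices below a vertex of least height
in `P`. -/
theorem monD_notMem_of_forall {P : Ideal (DomainD α F)} [hP : P.IsPrime] {A : Set (Vertex α)}
    (hA : ∀ y ∈ A, monD F (vertexMonomial y) ∉ P) (m : monomials α)
    (hm : (m : U α 0 → ℕ) ∈ AddSubmonoid.closure (exponent '' A)) : monD F m ∉ P := by
  obtain ⟨m, hm'⟩ := m
  change m ∈ _ at hm
  induction hm using AddSubmonoid.closure_induction with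
  | mem m hm =>
    obtain ⟨y, hy, rfl⟩ := hm
    exact hA y hy
  | zero =>
    intro h
    exact hP.ne_top ((Ideal.eq_top_iff_one _).2 (by rwa [← monD_zero]))
  | add a b ha hb iha ihb =>
    have hle : AddSubmonoid.closure (exponent '' A) ≤ monomials α :=
      AddSubmonoid.closure_mono (Set.image_subset_range _ _)
    rw [show (⟨a + b, hm'⟩ : monomials α) = ⟨a, hle ha⟩ + ⟨b, hle hb⟩ from rfl, monD_add]
    exact fun h => (hP.mem_or_mem h).elim (iha _) (ihb _)

theorem exists_vertex_mem {P : Ideal (DomainD α F)} [P.IsPrime] (hP : P ≠ ⊥) :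
    ∃ x : Vertex α, monD F (vertexMonomial x) ∈ P := by
  obtain ⟨d, hd, hd0⟩ := Submodule.exists_mem_ne_zero_of_ne_bot hP
  obtain ⟨m, hm⟩ := exists_associated_monD hd0
  by_contra! hcon
  refine monD_notMem_of_forall (A := Set.univ) (fun y _ => hcon y) m ?_
    (P.mem_of_dvd hm.symm.dvd hd)
  rw [Set.image_univ]
  exact m.2

theorem exists_eq_idealM {P : Ideal (DomainD α F)} [hP : P.IsPrime] (h0 : P ≠ ⊥) :
    ∃ x, P = idealM F x := by
  obtain ⟨x, hx, hmin⟩ := WellFounded.has_min (InvImage.wf (Vertex.height (α := α)) wellFounded_lt)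
    {x | monD F (vertexMonomial x) ∈ P} (exists_vertex_mem h0)
  refine ⟨x, ((idealM_isMaximal x).eq_of_le hP.ne_top (idealM_le_iff.2 fun δ h => ?_)).symm⟩
  have hx' : monD F (vertexMonomial (shift x _ (valid_seq x))) ∈ P := by rwa [shift_self]
  rcases le_total δ (x.seq x.height) with hle | hle
  · exact P.mem_of_dvd (monD_shift_dvd x h (valid_seq x) hle) hx'
  -- The cofactor `m` is a product of vertices of height less than that of `x`, hence not in `P` by
  -- minimality.
  · obtain ⟨m, hm, e⟩ := vertexMonomial_shift_of_le x (valid_seq x) h hle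
    rw [e, monD_add] at hx'
    exact (hP.mem_or_mem hx').resolve_left
      (monD_notMem_of_forall (fun y hy hyP => hmin y hyP hy.1) m hm)

end Algebra

/-- `Spec(D) = 𝓜 ∪ {0}`; moreover every ideal in `𝓜` is nonzero and maximal. -/
theorem mainTheorem2 (α : Ordinal.{u}) (F : Type v) [Field F] :
    {P : Ideal (DomainD α F) | P.IsPrime} = collM α F ∪ {⊥} ∧
      ∀ P ∈ collM α F, P.IsMaximal ∧ P ≠ ⊥ := by
  refine ⟨Set.ext fun P => ⟨fun hP => ?_, ?_⟩, ?_⟩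
  · have : P.IsPrime := hP
    by_cases h0 : P = ⊥
    · exact Or.inr h0
    · obtain ⟨x, rfl⟩ := exists_eq_idealM h0
      exact Or.inl ⟨x, rfl⟩
  · rintro (⟨x, rfl⟩ | h)
    · exact (idealM_isMaximal x).isPrime
    · rw [Set.mem_singleton_iff.1 h]
      exact Ideal.isPrime_bot
  · rintro _ ⟨x, rfl⟩
    exact ⟨idealM_isMaximal x, idealM_ne_bot x⟩
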